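/- Let $\mathbb F$ be a finite field, let $m\ge n$, and let $0\ne\mathcal C\le\mathbb F^{n\times m}$ be a (linear) rank-metric code. For $V\le\mathbb F^n$ and $W\le\mathbb F^m$ let $V^\perp$, $W^\perp$ be the orthogonal spaces with respect to the standard dot product, let $\mathcal C(V,\mathrm c)=\{M\in\mathcal C : \operatorname{colsp}(M)\le V\}$ and $\mathcal C(W,\mathrm r)=\{M\in\mathcal C : \operatorname{rowsp}(M)\le W\}$, and set \[ \rho_{\mathrm c}(V)=\frac{\dim\mathcal C-\dim\mathcal C(V^\perp,\mathrm c)}{m},\qquad \rho_{\mathrm r}(W)=\frac{\dim\mathcal C-\dim\mathcal C(W^\perp,\mathrm r)}{n}. \] These are the rank functions of the column and row $q$-polymatroids $\mathcal M_{\mathrm c}(\mathcal C)=(\mathbb F^n,\rho_{\mathrm c})$ and $\mathcal M_{\mathrm r}(\mathcal C)=(\mathbb F^m,\rho_{\mathrm r})$. A flat of a $q$-polymatroid $(E,\rho)$ is a subspace $F\le E$ with $\rho(F+\langle x\rangle)>\rho(F)$ for all $x\in E\setminus F$; let $\mathcal F_{\mathrm c}$, $\mathcal F_{\mathrm r}$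 be the sets of flats of $\mathcal M_{\mathrm c}(\mathcal C)$, $\mathcal M_{\mathrm r}(\mathcal C)$. A subspace $\mathcal A\le\mathbb F^{n\times m}$ is an optimal anticode if $\dim\mathcal A=m\cdot\max\{\operatorname{rk}(M) : M\in\mathcal A\}$. For $1\le i\le\dim\mathcal C$ define the generalized weight \[ a_i(\mathcal C)=\frac1m\min\{\dim\mathcal A : \mathcal A\le\mathbb F^{n\times m}\text{ an optimal anticode},\ \dim(\mathcal C\cap\mathcal A)\ge i\} \] and \begin{align*} b_i^{\mathrm c}(\mathcal C)&=n-\max\{\dim V : V\in\mathcal F_{\mathrm c},\ \rho_{\mathrm c}(V)\le\rho_{\mathrm c}(\mathbb F^n)-i/m\},\\ b_i^{\mathrm r}(\mathcal C)&=m-\max\{\dim W : W\in\mathcal F_{\mathrm r},\ \rho_{\mathrm r}(W)\le\rho_{\mathrm r}(\mathbb F^m)-i/n\}. \end{align*} Then the minimum and the maxima above are taken over nonempty sets, and for all $i=1,\dots,\dim\mathcal C$ \[ a_i(\mathcal C)=\begin{cases} b_i^{\mathrm c}(\mathcal C), & \text{if } m>n,\\ \min\{b_i^{\mathrm c}(\mathcal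 C),\,b_i^{\mathrm r}(\mathcal C)\}, & \text{if } m=n.\end{cases} \] Furthermore, if $m=n$, then $b_1^{\mathrm c}(\mathcal C)=b_1^{\mathrm r}(\mathcal C)$. -/

import Mathlib

/-- `rho` is a `q`-rank function: dimension-bounded, monotone and submodular. -/
structure IsQRankFunction {F E : Type*} [Field F] [AddCommGroup E] [Module F E]
    (rho : Submodule F E → ℚ) : Prop where
  nonneg : ∀ V, 0 ≤ rho V
  le_dim : ∀ V, rho V ≤ (Module.finrank F V : ℚ)
  mono : ∀ V W, V ≤ W → rho V ≤ rho W
  submodular : ∀ V W, rho (V ⊔ W) + rho (V ⊓ W) ≤ rho V + rho W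

/-- A `q`-polymatroid on a finite-dimensional vector space `E` over `F`. -/
structure QPolymatroid (F E : Type*) [Field F] [AddCommGroup E] [Module F E]
    [FiniteDimensional F E] where
  rho : Submodule F E → ℚ
  isQRankFunction : IsQRankFunction rho

namespace QPolymatroid

variable {F E : Type*} [Field F] [AddCommGroup E] [Module F E] [FiniteDimensional F E]

/-- A flat: adding any vector outside `V` strictly increases the rank. -/
def IsFlat (M : QPolymatroid F E) (V : Submodule F E) : Prop :=
  ∀ x : E, x ∉ V → M.rho V < M.rho (V ⊔ Submodule.span F {x})

/-- The dimensions of the flats whose rank is at most the rank of the `q`-polymatroid minus `t`. -/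
def flatDims (M : QPolymatroid F E) (t : ℚ) : Set ℕ :=
  {d | ∃ V : Submodule F E, M.IsFlat V ∧ M.rho V ≤ M.rho ⊤ - t ∧ Module.finrank F V = d}

end QPolymatroid

namespace RankMetric

open Module Matrix

variable {F : Type*} [Field F] {n m : ℕ}

/-- The orthogonal space with respect to the standard dot product. -/
def perp {l : ℕ} (V : Submodule F (Fin l → F)) : Submodule F (Fin l → F) where
  carrier := {w | ∀ v ∈ V, v ⬝ᵥ w = 0}
  zero_mem' := fun v _ => dotProduct_zero v
  add_mem' := fun {a b} ha hb v hv => by rw [dotProduct_add, ha v hv, hb v hv, add_zero]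
  smul_mem' := fun c x hx v hv => by rw [dotProduct_smul, hx v hv, smul_zero]

/-- The column space of a matrix. -/
def colsp (M : Matrix (Fin n) (Fin m) F) : Submodule F (Fin n → F) :=
  Submodule.span F (Set.range M.col)

/-- The row space of a matrix. -/
def rowsp (M : Matrix (Fin n) (Fin m) F) : Submodule F (Fin m → F) :=
  Submodule.span F (Set.range M.row)

theorem colsp_le_iff (M : Matrix (Fin n) (Fin m) F) (V : Submodule F (Fin n → F)) :
    colsp M ≤ V ↔ ∀ j, M.col j ∈ V := by
  rw [colsp, Submodule.span_le, Set.range_subset_iff]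
  rfl

theorem rowsp_le_iff (M : Matrix (Fin n) (Fin m) F) (W : Submodule F (Fin m → F)) :
    rowsp M ≤ W ↔ ∀ i, M.row i ∈ W := by
  rw [rowsp, Submodule.span_le, Set.range_subset_iff]
  rfl

/-- The column shortening `C(V, c)`: the matrices in `C` with column space inside `V`. -/
def shortenCol (C : Submodule F (Matrix (Fin n) (Fin m) F)) (V : Submodule F (Fin n → F)) :
    Submodule F (Matrix (Fin n) (Fin m) F) where
  carrier := {M | M ∈ C ∧ colsp M ≤ V}
  zero_mem' := ⟨C.zero_mem, (colsp_le_iff _ _).2 fun _ => V.zero_mem⟩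
  add_mem' := fun ha hb => ⟨C.add_mem ha.1 hb.1, (colsp_le_iff _ _).2 fun j =>
    V.add_mem ((colsp_le_iff _ _).1 ha.2 j) ((colsp_le_iff _ _).1 hb.2 j)⟩
  smul_mem' := fun c _ hx => ⟨C.smul_mem c hx.1, (colsp_le_iff _ _).2 fun j =>
    V.smul_mem c ((colsp_le_iff _ _).1 hx.2 j)⟩

/-- The row shortening `C(W, r)`: the matrices in `C` with row space inside `W`. -/
def shortenRow (C : Submodule F (Matrix (Fin n) (Fin m) F)) (W : Submodule F (Fin m → F)) :
    Submodule F (Matrix (Fin n) (Fin m) F) where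
  carrier := {M | M ∈ C ∧ rowsp M ≤ W}
  zero_mem' := ⟨C.zero_mem, (rowsp_le_iff _ _).2 fun _ => W.zero_mem⟩
  add_mem' := fun ha hb => ⟨C.add_mem ha.1 hb.1, (rowsp_le_iff _ _).2 fun j =>
    W.add_mem ((rowsp_le_iff _ _).1 ha.2 j) ((rowsp_le_iff _ _).1 hb.2 j)⟩
  smul_mem' := fun c _ hx => ⟨C.smul_mem c hx.1, (rowsp_le_iff _ _).2 fun j =>
    W.smul_mem c ((rowsp_le_iff _ _).1 hx.2 j)⟩

theorem perp_anti {l : ℕ} {V W : Submodule F (Fin l → F)} (h : V ≤ W) : perp W ≤ perp V :=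
  fun _ hx v hv => hx v (h hv)

theorem perp_sup {l : ℕ} (V W : Submodule F (Fin l → F)) : perp (V ⊔ W) = perp V ⊓ perp W := by
  apply le_antisymm
  · exact le_inf (perp_anti le_sup_left) (perp_anti le_sup_right)
  · rintro x ⟨hV, hW⟩ u hu
    obtain ⟨v, hv, w, hw, rfl⟩ := Submodule.mem_sup.1 hu
    rw [add_dotProduct, hV v hv, hW w hw, add_zero]

/-- The rank-function axioms for a family of subspaces `S V` of `C`. -/
theorem isQRankFunction_of_family {l k : ℕ} {X : Type*} [AddCommGroup X] [Module F X]
    [FiniteDimensional F X]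
    (C : Submodule F X) (S : Submodule F (Fin l → F) → Submodule F X)
    (hC : ∀ V, S V ≤ C) (hanti : ∀ V W, V ≤ W → S W ≤ S V)
    (hsup : ∀ V W, S V ⊓ S W ≤ S (V ⊔ W))
    (hdim : ∀ V, finrank F C ≤ finrank F (S V) + k * finrank F V) :
    IsQRankFunction (fun V => ((finrank F C : ℚ) - finrank F (S V)) / k) := by
  have hk : (0 : ℚ) ≤ k := Nat.cast_nonneg k
  refine ⟨fun V => ?_, fun V => ?_, fun V W h => ?_, fun V W => ?_⟩
  · have h : (finrank F (S V) : ℚ) ≤ finrank F C := by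
      exact_mod_cast Submodule.finrank_mono (hC V)
    exact div_nonneg (by linarith) hk
  · have h : (finrank F C : ℚ) ≤ finrank F (S V) + k * finrank F V := by exact_mod_cast hdim V
    exact div_le_of_le_mul₀ hk (Nat.cast_nonneg _) (by linarith)
  · have h : (finrank F (S W) : ℚ) ≤ finrank F (S V) := by
      exact_mod_cast Submodule.finrank_mono (hanti V W h)
    exact div_le_div_of_nonneg_right (by linarith) hk
  · have h1 : (finrank F (S V) : ℚ) + finrank F (S W) ≤
        finrank F (S (V ⊔ W)) + finrank F (S (V ⊓ W)) := by
      have e := Submodule.finrank_sup_add_finrank_inf_eq (S V) (S W)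
      have a := Submodule.finrank_mono (hsup V W)
      have b := Submodule.finrank_mono
        (sup_le (hanti _ _ (inf_le_left : V ⊓ W ≤ V)) (hanti _ _ (inf_le_right : V ⊓ W ≤ W)))
      exact_mod_cast (by omega : finrank F (S V) + finrank F (S W) ≤
        finrank F (S (V ⊔ W)) + finrank F (S (V ⊓ W)))
    rw [← add_div, ← add_div]
    exact div_le_div_of_nonneg_right (by linarith) hk

/-- If `S` contains the part of `C` killed by a linear map into `V → F^k`, then
`dim C ≤ dim S + k dim V`. -/
theorem dim_bound {l k : ℕ} {X : Type*} [AddCommGroup X] [Module F X] [FiniteDimensional F X]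
    (C S : Submodule F X) (V : Submodule F (Fin l → F)) (f : X →ₗ[F] (V →ₗ[F] (Fin k → F)))
    (h : ∀ x ∈ C, f x = 0 → x ∈ S) :
    finrank F C ≤ finrank F S + k * finrank F V := by
  have e := LinearMap.finrank_range_add_finrank_ker (f.comp C.subtype)
  have a : finrank F (LinearMap.range (f.comp C.subtype)) ≤ k * finrank F V := by
    refine (Submodule.finrank_le _).trans ?_
    rw [Module.finrank_linearMap, Module.finrank_fin_fun, mul_comm]
  have b : finrank F (LinearMap.ker (f.comp C.subtype)) ≤ finrank F S := by
    rw [← Submodule.finrank_map_subtype_eq]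
    apply Submodule.finrank_mono
    rintro _ ⟨x, hx, rfl⟩
    exact h x x.2 hx
  omega

theorem isQRankFunction_col (C : Submodule F (Matrix (Fin n) (Fin m) F)) :
    IsQRankFunction (fun V : Submodule F (Fin n → F) =>
      ((finrank F C : ℚ) - finrank F (shortenCol C (perp V))) / m) :=
  isQRankFunction_of_family (k := m) C (fun V => shortenCol C (perp V)) (fun _ _ h => h.1)
    (fun _ _ h _ hM => ⟨hM.1, hM.2.trans (perp_anti h)⟩)
    (fun V W _ hM => ⟨hM.1.1, by rw [perp_sup]; exact le_inf hM.1.2 hM.2.2⟩)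
    (fun V => dim_bound C _ V
      { toFun := fun M => M.vecMulLinear.comp V.subtype
        map_add' := fun A B => by ext v : 1; exact Matrix.vecMul_add A B _
        map_smul' := fun c A => by ext v : 1; exact Matrix.vecMul_smul _ c A }
      (fun M hM h => ⟨hM, (colsp_le_iff _ _).2 fun j v hv =>
        congrFun (LinearMap.congr_fun h ⟨v, hv⟩) j⟩))

theorem isQRankFunction_row (C : Submodule F (Matrix (Fin n) (Fin m) F)) :
    IsQRankFunction (fun W : Submodule F (Fin m → F) =>
      ((finrank F C : ℚ) - finrank F (shortenRow C (perp W))) / n) :=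
  isQRankFunction_of_family (k := n) C (fun W => shortenRow C (perp W)) (fun _ _ h => h.1)
    (fun _ _ h _ hM => ⟨hM.1, hM.2.trans (perp_anti h)⟩)
    (fun V W _ hM => ⟨hM.1.1, by rw [perp_sup]; exact le_inf hM.1.2 hM.2.2⟩)
    (fun W => dim_bound C _ W
      { toFun := fun M => M.mulVecLin.comp W.subtype
        map_add' := fun A B => by ext v : 1; exact Matrix.add_mulVec A B _
        map_smul' := fun c A => by ext v : 1; exact Matrix.smul_mulVec c A _ }
      (fun M hM h => ⟨hM, (rowsp_le_iff _ _).2 fun j v hv =>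
        (dotProduct_comm _ _).trans (congrFun (LinearMap.congr_fun h ⟨v, hv⟩) j)⟩))

/-- The column `q`-polymatroid of a code, with
`rho V = (dim C - dim C(V^⊥, c)) / m`. -/
noncomputable def colPM (C : Submodule F (Matrix (Fin n) (Fin m) F)) :
    QPolymatroid F (Fin n → F) where
  rho V := ((finrank F C : ℚ) - finrank F (shortenCol C (perp V))) / m
  isQRankFunction := isQRankFunction_col C

/-- The row `q`-polymatroid of a code, with
`rho W = (dim C - dim C(W^⊥, r)) / n`. -/
noncomputable def rowPM (C : Submodule F (Matrix (Fin n) (Fin m) F)) :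
    QPolymatroid F (Fin m → F) where
  rho W := ((finrank F C : ℚ) - finrank F (shortenRow C (perp W))) / n
  isQRankFunction := isQRankFunction_row C

/-- The maximum rank of a matrix in the code. -/
noncomputable def maxrk (C : Submodule F (Matrix (Fin n) (Fin m) F)) : ℕ :=
  sSup {r | ∃ M ∈ C, M.rank = r}

/-- Optimal anticodes in `F^{n×m}`, for `m ≥ n`. -/
def IsOptimalAnticode (A : Submodule F (Matrix (Fin n) (Fin m) F)) : Prop :=
  finrank F A = m * maxrk A

/-- The dimensions of the optimal anticodes that meet `C` in dimension at least `i`. -/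
def anticodeDims (C : Submodule F (Matrix (Fin n) (Fin m) F)) (i : ℕ) : Set ℕ :=
  {d | ∃ A : Submodule F (Matrix (Fin n) (Fin m) F),
    IsOptimalAnticode A ∧ i ≤ finrank F (C ⊓ A : Submodule F _) ∧ finrank F A = d}

/-- The `i`-th generalized weight `a_i(C)`, for `m ≥ n`. -/
noncomputable def genWeight (C : Submodule F (Matrix (Fin n) (Fin m) F)) (i : ℕ) : ℚ :=
  (1 / (m : ℚ)) * (sInf (anticodeDims C i) : ℕ)

/-- `b_i^c(C)`: `n` minus the maximal dimension of a flat of the column `q`-polymatroid of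
rank at most `rho_c(F^n) - i/m`. -/
noncomputable def flatWeightCol (C : Submodule F (Matrix (Fin n) (Fin m) F)) (i : ℕ) : ℚ :=
  (n : ℚ) - (sSup ((colPM C).flatDims ((i : ℚ) / m)) : ℕ)

/-- `b_i^r(C)`: `m` minus the maximal dimension of a flat of the row `q`-polymatroid of
rank at most `rho_r(F^m) - i/n`. -/
noncomputable def flatWeightRow (C : Submodule F (Matrix (Fin n) (Fin m) F)) (i : ℕ) : ℚ :=
  (m : ℚ) - (sSup ((rowPM C).flatDims ((i : ℚ) / n)) : ℕ)

end RankMetric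

/-! ### Spaces of linear maps of bounded rank -/

namespace LinearMap

open Module

variable {F E G : Type*} [Field F] [AddCommGroup E] [Module F E] [AddCommGroup G] [Module F G]

/-! Flats can be eliminated at once: a largest subspace of rank at most `rho ⊤ - t` is a flat,
because adding a vector must push the rank over the bound. Passing to orthogonal spaces, the column
and row weights become the least `dim U` with `dim C(U, c) ≥ i`, respectively `dim C(U, r) ≥ i`. The
matrices with column space in `U` (for m = n also those with row space in `U`) form an optimal
anticode of dimension `m * dim U`. So it suffices that every optimal anticode lies in such a
standard one of no larger dimension, of row type only if m = n (`exists_range_le_or_exists_le_ker`).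
For i = 1 and m = n both weights are the minimum rank of a nonzero codeword.

The containment concerns a space `A` of maps `E → G` of rank at most r, with `dim G ≤ dim E` and
`dim A = dim E * r`. For an ordered basis of `E`, the dimensions of the leading spaces of `A` add up
to `dim A`, and k independent vectors from distinct leading spaces give a map in `A` of rank at
least k. Hence r + 1 such vectors cannot exist. For r < `dim G`, counting then shows that the
leading spaces all have dimension r or, in the square case, are each 0 or `G`. With a basis adapted
to a form φ ≠ 0 this says that {g : φ ⊗ g ∈ A} has dimension r or, in the square case, is 0 or `G`.

If the dimension is r for every φ, then `A` is the space of all maps into the range of one map of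
rank r. If some φ gives `G`, restriction to ker φ lowers the rank bound by one and leads to a
nonsquare problem. If some φ gives 0, restriction to ker φ is injective on `A`, and comparing maps
with their extensions produces another form that gives `G`. -/

/-- The maps in `A` that vanish on all basis vectors of index at least `k`. -/
def tailVanishing {m : ℕ} (A : Submodule F (E →ₗ[F] G)) (b : Basis (Fin m) F E) (k : ℕ) :
    Submodule F (E →ₗ[F] G) where
  carrier := {f | f ∈ A ∧ ∀ i : Fin m, k ≤ i → f (b i) = 0}
  zero_mem' := ⟨A.zero_mem, fun _ _ => rfl⟩
  add_mem' := fun hf hg => ⟨A.add_mem hf.1 hg.1, fun i hi => by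
    rw [add_apply, hf.2 i hi, hg.2 i hi, add_zero]⟩
  smul_mem' := fun c _ hf => ⟨A.smul_mem c hf.1, fun i hi => by
    rw [smul_apply, hf.2 i hi, smul_zero]⟩

/-- The values at `b j` of the maps in `A` that vanish on all later basis vectors. -/
noncomputable def leadingSpace {m : ℕ} (A : Submodule F (E →ₗ[F] G)) (b : Basis (Fin m) F E) (j : Fin m) :
    Submodule F G :=
  (tailVanishing A b (j + 1)).map (applyₗ (b j))

theorem mem_leadingSpace {m : ℕ} {A : Submodule F (E →ₗ[F] G)} {b : Basis (Fin m) F E}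
    {j : Fin m} {g : G} :
    g ∈ leadingSpace A b j ↔ ∃ f ∈ A, (∀ i, j < i → f (b i) = 0) ∧ f (b j) = g := by
  constructor
  · rintro ⟨f, hf, rfl⟩
    exact ⟨f, hf.1, fun i hi => hf.2 i hi, rfl⟩
  · rintro ⟨f, hf, h, rfl⟩
    exact ⟨f, ⟨hf, fun i hi => h i hi⟩, rfl⟩

theorem finrank_tailVanishing_succ [FiniteDimensional F E] [FiniteDimensional F G] {m : ℕ}
    (A : Submodule F (E →ₗ[F] G)) (b : Basis (Fin m) F E) (j : Fin m) :
    finrank F (tailVanishing A b (j + 1)) =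
      finrank F (leadingSpace A b j) + finrank F (tailVanishing A b j) := by
  have e := finrank_range_add_finrank_ker
    ((applyₗ (b j) : (E →ₗ[F] G) →ₗ[F] G).domRestrict (tailVanishing A b (j + 1)))
  rw [range_domRestrict] at e
  rw [← e, leadingSpace, ← Submodule.finrank_map_subtype_eq]
  have : Submodule.map (tailVanishing A b (j + 1)).subtype
      (ker ((applyₗ (b j) : (E →ₗ[F] G) →ₗ[F] G).domRestrict (tailVanishing A b (j + 1))))
      = tailVanishing A b j := by
    ext f
    constructor
    · rintro ⟨⟨f, hf⟩, h, rfl⟩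
      refine ⟨hf.1, fun i hi => ?_⟩
      rcases Nat.lt_or_eq_of_le hi with h1 | h1
      · exact hf.2 i h1
      · rw [← Fin.ext h1]; exact h
    · intro hf
      exact ⟨⟨f, hf.1, fun i hi => hf.2 i (by omega)⟩, hf.2 j le_rfl, rfl⟩
  rw [this]

/-- The spaces `tailVanishing A b k` filter `A` from 0 at k = 0 to `A` at k = m; evaluation at `b j`
identifies each successive quotient with a leading space. -/
theorem sum_finrank_leadingSpace [FiniteDimensional F E] [FiniteDimensional F G] {m : ℕ}
    (A : Submodule F (E →ₗ[F] G)) (b : Basis (Fin m) F E) :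
    ∑ j, finrank F (leadingSpace A b j) = finrank F A := by
  have key : ∀ k : ℕ, k ≤ m → finrank F (tailVanishing A b k) =
      ∑ j : Fin m with j.val < k, finrank F (leadingSpace A b j) := by
    intro k
    induction k with
    | zero =>
      intro _
      have : tailVanishing A b 0 = ⊥ := by
        rw [eq_bot_iff]
        intro f hf
        exact b.ext fun i => hf.2 i (Nat.zero_le _)
      simp [this]
    | succ k ih =>
      intro hk
      have h1 := finrank_tailVanishing_succ A b ⟨k, hk⟩
      have h2 : (Finset.univ.filter fun j : Fin m => j.val < k + 1) =
          insert ⟨k, hk⟩ (Finset.univ.filter fun j : Fin m => j.val < k) := by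
        ext j
        simp [Fin.ext_iff]
        omega
      rw [h2, Finset.sum_insert (by simp), ← ih (by omega)]
      exact h1
  have h3 : tailVanishing A b m = A := by
    ext f
    exact ⟨fun h => h.1, fun h => ⟨h, fun i hi => absurd i.2 (by omega)⟩⟩
  have := key m le_rfl
  rw [h3] at this
  rw [this]
  congr 1
  ext j
  simp

/-- Linearly independent elements of distinct leading spaces produce a map of large rank. -/
theorem exists_card_le_finrank_range [FiniteDimensional F G] {m : ℕ}
    {A : Submodule F (E →ₗ[F] G)} {b : Basis (Fin m) F E} (J : Finset (Fin m)) (g : Fin m → G)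
    (hg : ∀ j ∈ J, g j ∈ leadingSpace A b j) (hli : LinearIndepOn F g (J : Set (Fin m))) :
    ∃ f ∈ A, J.card ≤ finrank F (range f) := by
  classical
  have key : ∀ I : Finset (Fin m), I ⊆ J → ∃ f ∈ A,
      LinearIndepOn F (fun j => if j ∈ I then f (b j) else g j) (J : Set (Fin m)) := by
    intro I
    -- Indices are processed from the largest down: the correcting map `p` vanishes at all later
    -- basis vectors, so the values already installed do not change.
    induction I using Finset.induction_on_min with
    | empty => intro _; exact ⟨0, A.zero_mem, by simpa using hli⟩
    | insert a s has ih =>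
      intro hI
      obtain ⟨f, hf, hind⟩ := ih ((Finset.subset_insert _ _).trans hI)
      have haJ : a ∈ J := hI (Finset.mem_insert_self _ _)
      have hns : a ∉ s := fun h => lt_irrefl _ (has a h)
      obtain ⟨p, hpA, hp0, hpa⟩ := mem_leadingSpace.1 (hg a haJ)
      have hJ : (J : Set (Fin m)) = insert a (J \ {a} : Set (Fin m)) := by
        rw [Set.insert_sdiff_singleton, Set.insert_eq_of_mem (by exact_mod_cast haJ)]
      have hna : a ∉ (J \ {a} : Set (Fin m)) := by simp
      rw [hJ, linearIndepOn_insert hna] at hind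
      obtain ⟨hR, hga⟩ := hind
      simp only [hns, if_false] at hga
      have main : ∀ c : F, f (b a) + c • g a ∉ Submodule.span F
          ((fun j => if j ∈ s then f (b j) else g j) '' (J \ {a} : Set (Fin m))) →
          ∃ f ∈ A, LinearIndepOn F (fun j => if j ∈ insert a s then f (b j) else g j)
            (J : Set (Fin m)) := by
        intro c hc
        have heq : Set.EqOn (fun j => if j ∈ s then f (b j) else g j)
            (fun j => if j ∈ insert a s then (f + c • p) (b j) else g j)
            (J \ {a} : Set (Fin m)) := by
          intro j hj
          have hja : j ≠ a := fun h => hj.2 h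
          by_cases hjs : j ∈ s
          · simp [hjs, hp0 j (has j hjs)]
          · simp [hjs, hja]
        refine ⟨f + c • p, A.add_mem hf (A.smul_mem c hpA), ?_⟩
        rw [hJ, linearIndepOn_insert hna]
        refine ⟨hR.congr heq, ?_⟩
        rw [← heq.image_eq]
        simpa [hpa] using hc
      -- Since `g a` is outside the span, `f (b a)` and `f (b a) + g a` cannot both be inside it; so
      -- a coefficient 0 or 1 suffices over any field.
      by_cases h0 : f (b a) ∈ Submodule.span F
          ((fun j => if j ∈ s then f (b j) else g j) '' (J \ {a} : Set (Fin m)))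
      · refine main 1 fun h => hga ?_
        have := Submodule.sub_mem _ h h0
        simpa using this
      · exact main 0 (by simpa using h0)
  obtain ⟨f, hf, hind⟩ := key J subset_rfl
  refine ⟨f, hf, ?_⟩
  have h1 : LinearIndepOn F (fun j => f (b j)) (J : Set (Fin m)) :=
    hind.congr fun j hj => by simp [Finset.mem_coe.1 hj]
  have h2 : LinearIndependent F (fun j : J => (⟨f (b j), ⟨b j, rfl⟩⟩ : range f)) := by
    apply LinearIndependent.of_comp (range f).subtype
    exact h1
  simpa using h2.fintype_card_le_finrank

/-- Greedy choice of linearly independent elements from distinct subspaces. -/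
theorem exists_linearIndepOn_of_card_le [FiniteDimensional F G] {ι : Type*}
    (V : ι → Submodule F G) (k : ℕ) :
    ∀ S : Finset ι, (∀ t < k, k - t ≤ (S.filter fun j => t < finrank F (V j)).card) →
      ∃ J ⊆ S, J.card = k ∧ ∃ g : ι → G, (∀ j ∈ J, g j ∈ V j) ∧
        LinearIndepOn F g (J : Set ι) := by
  classical
  induction k with
  | zero =>
    intro S _
    exact ⟨∅, Finset.empty_subset _, rfl, 0, by simp, by simp⟩
  | succ k ih =>
    intro S hS
    -- The case t = k provides a space of dimension greater than k. It is held back to the end, when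
    -- k vectors cannot span it.
    obtain ⟨a, ha⟩ := Finset.card_pos.1 (lt_of_lt_of_le (by omega) (hS k (by omega)))
    rw [Finset.mem_filter] at ha
    obtain ⟨J, hJS, hJk, g, hg, hli⟩ := ih (S.erase a) (fun t ht => by
      rw [Finset.filter_erase]
      have h1 := hS t (by omega)
      have h2 := Finset.pred_card_le_card_erase
        (s := S.filter fun j => t < finrank F (V j)) (a := a)
      omega)
    have haJ : a ∉ J := fun h => by simpa using hJS h
    have hspan : finrank F (Submodule.span F (g '' (J : Set ι))) ≤ k := by
      rw [← Finset.coe_image]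
      exact (finrank_span_finset_le_card _).trans (Finset.card_image_le.trans hJk.le)
    obtain ⟨x, hxV, hx⟩ : ∃ x ∈ V a, x ∉ Submodule.span F (g '' (J : Set ι)) := by
      by_contra! h
      have := Submodule.finrank_mono (show V a ≤ _ from h)
      omega
    have heq : Set.EqOn g (Function.update g a x) (J : Set ι) := fun j hj => by
      rw [Function.update_of_ne]
      rintro rfl
      exact haJ hj
    refine ⟨insert a J, Finset.insert_subset ha.1 (hJS.trans (Finset.erase_subset _ _)), ?_,
      Function.update g a x, ?_, ?_⟩
    · rw [Finset.card_insert_of_notMem haJ, hJk]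
    · intro j hj
      rcases Finset.mem_insert.1 hj with rfl | hj
      · simpa using hxV
      · rw [← heq hj]; exact hg j hj
    · rw [Finset.coe_insert, linearIndepOn_insert (by simpa using haJ)]
      refine ⟨hli.congr heq, ?_⟩
      rw [← heq.image_eq]
      simpa using hx

/-- A family of `m` dimensions bounded by `n ≤ m`, with few large members, has small sum. -/
theorem sum_le_and_eq_of_card_filter_le {n m r t : ℕ} (hnm : n ≤ m) (hr : r < n) (ht : t ≤ r)
    (d : Fin m → ℕ) (hd : ∀ j, d j ≤ n)
    (hcard : (Finset.univ.filter fun j => t < d j).card ≤ r - t) :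
    ∑ j, d j ≤ m * r ∧ (∑ j, d j = m * r →
      (∀ j, d j = r) ∨ (n = m ∧ ∀ j, d j = 0 ∨ d j = n)) := by
  -- Slack variables remove subtraction: u = r - t, v = m - n, and below w = r - t - |S| and z = n -
  -- r - 1.
  obtain ⟨u, rfl⟩ := Nat.exists_eq_add_of_le ht
  obtain ⟨v, rfl⟩ := Nat.exists_eq_add_of_le hnm
  rw [Nat.add_sub_cancel_left] at hcard
  set S := Finset.univ.filter fun j => t < d j with hS
  have hcompl : S.card + Sᶜ.card = n + v := by
    rw [Finset.card_add_card_compl, Fintype.card_fin]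
  have hbd : ∀ j, d j ≤ if j ∈ S then n else t := fun j => by
    by_cases h : j ∈ S
    · simpa [h] using hd j
    · simp only [h, if_false]
      simpa [hS] using h
  have hsum : ∑ j, (if j ∈ S then n else t) = S.card * n + Sᶜ.card * t := by
    rw [← Finset.sum_add_sum_compl S]
    congr 1
    · rw [Finset.sum_congr rfl fun j hj => if_pos hj, Finset.sum_const, smul_eq_mul]
    · rw [Finset.sum_congr rfl fun j hj => if_neg (Finset.mem_compl.1 hj), Finset.sum_const,
        smul_eq_mul]
  have hle := Finset.sum_le_sum (s := Finset.univ) fun j _ => hbd j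
  rw [hsum] at hle
  obtain ⟨w, hw⟩ := Nat.exists_eq_add_of_le hcard
  obtain ⟨z, rfl⟩ := Nat.exists_eq_add_of_lt hr
  have hCz : (Sᶜ.card : ℤ) = t + z + 1 + v + w := by omega
  -- The last bracket is the gap between `m * r` and the bound on the sum. It is nonnegative, and
  -- its vanishing forces u = 0 (all dimensions are r) or v = t = 0 (square, dimensions 0 or n).
  have hident : (t + u + z + 1 + v) * (t + u) =
      S.card * (t + u + z + 1) + Sᶜ.card * t + (u * (v + t) + w * (u + z + 1)) := by
    have hSz : (S.card : ℤ) = u - w := by omega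
    zify
    rw [hCz, hSz]
    ring
  refine ⟨by omega, fun heq => ?_⟩
  have h0 : u * (v + t) + w * (u + z + 1) = 0 := by omega
  have hall : ∀ j, d j = if j ∈ S then t + u + z + 1 else t := by
    have := (Finset.sum_eq_sum_iff_of_le (s := Finset.univ) fun j _ => hbd j).1
      (by rw [hsum]; omega)
    exact fun j => this j (Finset.mem_univ _)
  rcases Nat.eq_zero_or_pos u with hu | hu
  · left
    have hS0 : S = ∅ := Finset.card_eq_zero.1 (by omega)
    intro j
    rw [hall j, hS0]
    simp [hu]
  · right
    have h1 : u * (v + t) = 0 := by omega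
    rcases Nat.mul_eq_zero.1 h1 with h | h
    · omega
    · refine ⟨by omega, fun j => ?_⟩
      rw [hall j]
      split_ifs
      · exact Or.inr rfl
      · left; omega

/-- A map of rank r + 1 is excluded, so the greedy choice of r + 1 independent vectors must fail at
some threshold t; the counting lemma applies to that t. -/
theorem finrank_leadingSpace_dichotomy [FiniteDimensional F E] [FiniteDimensional F G] {m r : ℕ}
    (hGE : finrank F G ≤ m) (hr : r < finrank F G) (A : Submodule F (E →ₗ[F] G))
    (b : Basis (Fin m) F E) (hA : ∀ f ∈ A, finrank F (range f) ≤ r) :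
    finrank F A ≤ m * r ∧ (finrank F A = m * r →
      (∀ j, finrank F (leadingSpace A b j) = r) ∨
      (finrank F G = m ∧ ∀ j, finrank F (leadingSpace A b j) = 0 ∨
        finrank F (leadingSpace A b j) = finrank F G)) := by
  obtain ⟨t, ht, hcard⟩ : ∃ t ≤ r,
      (Finset.univ.filter fun j => t < finrank F (leadingSpace A b j)).card ≤ r - t := by
    by_contra! h
    obtain ⟨J, -, hJ, g, hg, hli⟩ := exists_linearIndepOn_of_card_le (leadingSpace A b) (r + 1)
      Finset.univ (fun t ht => by have := h t (by omega); omega)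
    obtain ⟨f, hf, hle⟩ := exists_card_le_finrank_range J g hg hli
    have := hA f hf
    omega
  rw [← sum_finrank_leadingSpace A b]
  exact sum_le_and_eq_of_card_filter_le hGE hr ht _ (fun j => Submodule.finrank_le _) hcard

/-- A space of linear maps of rank at most `r` has dimension at most `r` times the larger of the
two dimensions. -/
theorem finrank_le_mul_of_forall_finrank_range_le [FiniteDimensional F E] [FiniteDimensional F G]
    {r : ℕ} (hGE : finrank F G ≤ finrank F E) (A : Submodule F (E →ₗ[F] G))
    (hA : ∀ f ∈ A, finrank F (range f) ≤ r) : finrank F A ≤ finrank F E * r := by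
  rcases lt_or_ge r (finrank F G) with hr | hr
  · exact (finrank_leadingSpace_dichotomy hGE hr A (finBasis F E) hA).1
  · refine (Submodule.finrank_le A).trans ?_
    rw [finrank_linearMap]
    exact Nat.mul_le_mul_left _ hr

/-! ### Rank-one maps in a space of maximal dimension -/

/-- The vectors `g` such that the rank-one map `x ↦ φ x • g` lies in `A`. -/
def rankOneSpace (A : Submodule F (E →ₗ[F] G)) (φ : Dual F E) : Submodule F G :=
  A.comap (smulRightₗ φ)

theorem mem_rankOneSpace {A : Submodule F (E →ₗ[F] G)} {φ : Dual F E} {g : G} :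
    g ∈ rankOneSpace A φ ↔ φ.smulRight g ∈ A := Iff.rfl

/-- A map vanishing on the kernel of `φ` is a multiple of `φ`. -/
theorem eq_smulRight_of_ker_le {φ : Dual F E} {y : E} (hy : φ y = 1) {f : E →ₗ[F] G}
    (h : ∀ x, φ x = 0 → f x = 0) : f = φ.smulRight (f y) := by
  ext x
  have := h (x - φ x • y) (by simp [hy])
  rw [map_sub, map_smul, sub_eq_zero] at this
  simpa using this

/-- Every nonzero linear form is, up to scaling, a member of a dual basis. -/
theorem exists_basis_of_apply_eq_one [FiniteDimensional F E] {φ : Dual F E} {y : E}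
    (hy : φ y = 1) {k : ℕ} (hk : finrank F E = k + 1) :
    ∃ b : Basis (Fin (k + 1)) F E, b 0 = y ∧ ∀ i, 0 < i → φ (b i) = 0 := by
  have hφ : φ ≠ 0 := by rintro rfl; simp at hy
  have hker : finrank F (ker φ) = k := by
    have := Module.Dual.finrank_ker_add_one_of_ne_zero hφ
    omega
  refine ⟨Basis.mkFinCons y (finBasisOfFinrankEq F (ker φ) hker) (fun c x hx h => ?_)
    (fun z => ⟨-φ z, ?_⟩), ?_, fun i hi => ?_⟩
  · have := congrArg φ h
    simpa [hy, mem_ker.1 hx] using this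
  · simp [hy]
  · simp [Basis.coe_mkFinCons]
  · rw [Basis.coe_mkFinCons]
    obtain ⟨j, rfl⟩ := Fin.exists_succ_eq.2 hi.ne'
    simp

theorem exists_apply_eq_one {φ : Dual F E} (hφ : φ ≠ 0) : ∃ y, φ y = 1 := by
  obtain ⟨x, hx⟩ := DFunLike.ne_iff.1 hφ
  exact ⟨(φ x)⁻¹ • x, by simpa using inv_mul_cancel₀ hx⟩

/-- In a basis whose vectors of positive index lie in ker φ, a map vanishing on those vectors is a
multiple of φ. So the leading space at index 0 is the rank-one space of φ. -/
theorem finrank_rankOneSpace_trichotomy [FiniteDimensional F E] [FiniteDimensional F G] {r : ℕ}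
    (hGE : finrank F G ≤ finrank F E) (hr : r < finrank F G) (A : Submodule F (E →ₗ[F] G))
    (hA : ∀ f ∈ A, finrank F (range f) ≤ r) (hdim : finrank F A = finrank F E * r)
    {φ : Dual F E} (hφ : φ ≠ 0) :
    finrank F (rankOneSpace A φ) = r ∨ (finrank F G = finrank F E ∧
      (rankOneSpace A φ = ⊥ ∨ rankOneSpace A φ = ⊤)) := by
  obtain ⟨k, hk⟩ : ∃ k, finrank F E = k + 1 := Nat.exists_eq_succ_of_ne_zero (by omega)
  obtain ⟨y, hy⟩ := exists_apply_eq_one hφ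
  obtain ⟨b, hb0, hb⟩ := exists_basis_of_apply_eq_one hy hk
  have heq : leadingSpace A b 0 = rankOneSpace A φ := by
    ext g
    rw [mem_leadingSpace, mem_rankOneSpace]
    constructor
    · rintro ⟨f, hf, h0, rfl⟩
      convert hf
      refine (b.ext fun i => ?_).symm
      rcases Fin.eq_zero_or_eq_succ i with rfl | ⟨j, rfl⟩
      · simp [hb0, hy]
      · simp [h0 _ (Fin.succ_pos j), hb _ (Fin.succ_pos j)]
    · intro h
      exact ⟨_, h, fun i hi => by simp [hb i hi], by simp [hb0, hy]⟩
  rw [hk] at hGE hdim ⊢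
  rcases (finrank_leadingSpace_dichotomy hGE hr A b hA).2 hdim with h | ⟨h1, h2⟩
  · exact Or.inl (heq ▸ h 0)
  · refine Or.inr ⟨h1, ?_⟩
    have h3 := h2 0
    rw [heq] at h3
    exact h3.imp Submodule.finrank_eq_zero.1 Submodule.eq_top_of_finrank_eq

end LinearMap

/-! ### Classification when all rank-one spaces have dimension r, and the nonsquare case -/

namespace LinearMap

open Module

variable {F E G : Type*} [Field F] [AddCommGroup E] [Module F E] [AddCommGroup G] [Module F G]

theorem mem_range_compRight_subtype_iff (V : Submodule F G) (f : E →ₗ[F] G) :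
    f ∈ range (V.subtype.compRight F (M := E)) ↔ range f ≤ V := by
  constructor
  · rintro ⟨h, rfl⟩ _ ⟨x, rfl⟩
    exact (h x).2
  · intro h
    exact ⟨f.codRestrict V fun x => h ⟨x, rfl⟩, rfl⟩

variable [FiniteDimensional F E] [FiniteDimensional F G]

theorem finrank_range_compRight_subtype (V : Submodule F G) :
    finrank F (range (V.subtype.compRight F (M := E))) = finrank F E * finrank F V := by
  rw [finrank_range_of_inj, finrank_linearMap]
  intro f g h
  ext x
  exact LinearMap.congr_fun h x

/-- If all rank-one spaces of a space of maps of rank at most `r` have dimension `r`, and the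
space has the maximal dimension, then it consists of all maps into an `r`-dimensional subspace. -/
theorem exists_forall_mem_iff_range_le_of_finrank_rankOneSpace {r : ℕ}
    (hGE : finrank F G ≤ finrank F E) (hr : r < finrank F G) (A : Submodule F (E →ₗ[F] G))
    (hA : ∀ f ∈ A, finrank F (range f) ≤ r) (hdim : finrank F A = finrank F E * r)
    (h : ∀ φ : Dual F E, φ ≠ 0 → finrank F (rankOneSpace A φ) = r) :
    ∃ V : Submodule F G, finrank F V = r ∧ ∀ f, f ∈ A ↔ range f ≤ V := by
  -- Otherwise all ranks are at most r - 1, and the dimension bound for r - 1 contradicts `hdim`.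
  obtain ⟨f, hf, hfr⟩ : ∃ f ∈ A, finrank F (range f) = r := by
    by_contra! hne
    have h1 := finrank_le_mul_of_forall_finrank_range_le hGE A (r := r - 1) fun f hf => by
      have := hA f hf
      have := hne f hf
      omega
    rcases Nat.eq_zero_or_pos r with h0 | h0
    · exact hne 0 A.zero_mem (by simp [h0])
    · rw [hdim] at h1
      have := Nat.le_of_mul_le_mul_left h1 (by omega)
      omega
  have hgood : ∀ φ : Dual F E, (∃ x ∈ ker f, φ x ≠ 0) → rankOneSpace A φ = range f := by
    rintro φ ⟨x, hx, hφx⟩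
    have hφ : φ ≠ 0 := by rintro rfl; simp at hφx
    refine Submodule.eq_of_le_of_finrank_eq (fun g hg => ?_) (by rw [h φ hφ, hfr])
    by_contra hgf
    -- A vector of ker f on which φ is nonzero puts g into the range of f + φ ⊗ g, hence also range
    -- f; for g outside range f the rank would exceed r.
    have hle : range f ⊔ Submodule.span F {g} ≤ range (f + φ.smulRight g) := by
      have hgm : g ∈ range (f + φ.smulRight g) :=
        ⟨(φ x)⁻¹ • x, by simp [mem_ker.1 hx, hφx]⟩
      refine sup_le ?_ ((Submodule.span_singleton_le_iff_mem _ _).2 hgm)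
      rintro _ ⟨z, rfl⟩
      have : f z = (f + φ.smulRight g) z - φ z • g := by simp
      rw [this]
      exact Submodule.sub_mem _ ⟨z, rfl⟩ (Submodule.smul_mem _ _ hgm)
    have h1 : finrank F (range f) < finrank F (range f ⊔ Submodule.span F {g} : Submodule F G) := by
      apply Submodule.finrank_lt_finrank_of_lt
      refine lt_of_le_of_ne le_sup_left fun he => hgf ?_
      rw [he]
      exact Submodule.mem_sup_right (Submodule.mem_span_singleton_self g)
    have h2 := Submodule.finrank_mono hle
    have h3 := hA _ (A.add_mem hf (mem_rankOneSpace.1 hg))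
    omega
  obtain ⟨x₀, hx₀, hx₀0⟩ : ∃ x ∈ ker f, x ≠ 0 := by
    by_contra! hk
    have h1 : ker f = ⊥ := (Submodule.eq_bot_iff _).2 hk
    have h2 := finrank_range_add_finrank_ker f
    rw [h1, finrank_bot] at h2
    omega
  obtain ⟨φ₀, hφ₀⟩ : ∃ φ₀ : Dual F E, φ₀ x₀ ≠ 0 := by
    by_contra! hk
    exact hx₀0 ((forall_dual_apply_eq_zero_iff F x₀).1 hk)
  have hall : ∀ φ : Dual F E, range f ≤ rankOneSpace A φ := by
    intro φ g hg
    -- A form vanishing at `x₀` is the sum of `φ₀` and `φ - φ₀`, neither of which vanishes there.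
    by_cases hφ : φ x₀ = 0
    · have h1 : g ∈ rankOneSpace A φ₀ := by rw [hgood φ₀ ⟨x₀, hx₀, hφ₀⟩]; exact hg
      have h2 : g ∈ rankOneSpace A (φ - φ₀) := by
        rw [hgood (φ - φ₀) ⟨x₀, hx₀, by simpa [hφ] using hφ₀⟩]; exact hg
      rw [mem_rankOneSpace] at *
      convert A.add_mem h1 h2 using 1
      ext x
      simp [sub_smul]
    · rw [hgood φ ⟨x₀, hx₀, hφ⟩]; exact hg
  have hsub : range ((range f).subtype.compRight F (M := E)) ≤ A := by
    intro p hp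
    rw [mem_range_compRight_subtype_iff] at hp
    let b := finBasis F E
    have hpe : p = ∑ i, (b.coord i).smulRight (p (b i)) := by
      refine b.ext fun j => ?_
      simp [Finsupp.single_apply]
    rw [hpe]
    exact A.sum_mem fun i _ => mem_rankOneSpace.1 (hall _ (hp ⟨b i, rfl⟩))
  have heq := Submodule.eq_of_le_of_finrank_eq hsub
    (by rw [finrank_range_compRight_subtype, hfr, hdim])
  refine ⟨range f, hfr, fun p => ?_⟩
  rw [← mem_range_compRight_subtype_iff, heq]

/-- Maximal spaces of bounded rank, for a domain of larger dimension than the codomain. -/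
theorem exists_forall_mem_iff_range_le {r : ℕ}
    (hGE : finrank F G < finrank F E) (hr : r ≤ finrank F G) (A : Submodule F (E →ₗ[F] G))
    (hA : ∀ f ∈ A, finrank F (range f) ≤ r) (hdim : finrank F E * r ≤ finrank F A) :
    ∃ V : Submodule F G, finrank F V = r ∧ ∀ f, f ∈ A ↔ range f ≤ V := by
  have hdim' := le_antisymm (finrank_le_mul_of_forall_finrank_range_le hGE.le A hA) hdim
  rcases hr.lt_or_eq with hr | hr
  · refine exists_forall_mem_iff_range_le_of_finrank_rankOneSpace hGE.le hr A hA hdim'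
      fun φ hφ => ?_
    rcases finrank_rankOneSpace_trichotomy hGE.le hr A hA hdim' hφ with h | ⟨h, -⟩
    · exact h
    · omega
  · have hAtop : A = ⊤ := Submodule.eq_top_of_finrank_eq (by rw [hdim', hr, finrank_linearMap])
    exact ⟨⊤, by rw [finrank_top, hr], by simp [hAtop]⟩

/-- Maximal spaces of bounded rank, for a codomain of larger dimension than the domain. -/
theorem exists_forall_mem_iff_le_ker {r : ℕ}
    (hEG : finrank F E < finrank F G) (hr : r ≤ finrank F E) (A : Submodule F (E →ₗ[F] G))
    (hA : ∀ f ∈ A, finrank F (range f) ≤ r) (hdim : finrank F G * r ≤ finrank F A) :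
    ∃ K : Submodule F E, finrank F K + r = finrank F E ∧ ∀ f, f ∈ A ↔ K ≤ ker f := by
  have hinj : Function.Injective (Module.Dual.transpose (R := F) (M := E) (M' := G)) := by
    intro f g h
    ext x
    rw [← sub_eq_zero, ← forall_dual_apply_eq_zero_iff F]
    intro γ
    have := LinearMap.congr_fun (LinearMap.congr_fun h γ) x
    simpa [sub_eq_zero, Module.Dual.transpose_apply] using this
  -- Transposition preserves rank and exchanges the two dimensions; the kernel sought is the
  -- coannihilator of the space `V` found for the transposes.
  obtain ⟨V, hV, hmem⟩ := exists_forall_mem_iff_range_le (F := F) (E := Dual F G) (G := Dual F E)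
    (r := r) (by simpa using hEG) (by simpa using hr) (A.map Module.Dual.transpose)
    (by
      rintro _ ⟨f, hf, rfl⟩
      exact (finrank_range_dualMap_eq_finrank_range f).trans_le (hA f hf))
    (by
      rw [← (Submodule.equivMapOfInjective _ hinj A).finrank_eq, Subspace.dual_finrank_eq]
      exact hdim)
  refine ⟨V.dualCoannihilator, ?_, fun f => ?_⟩
  · rw [← hV, add_comm]
    exact Subspace.finrank_add_finrank_dualCoannihilator_eq V
  · have h1 : f ∈ A ↔ Module.Dual.transpose f ∈ A.map (Module.Dual.transpose (R := F)) := by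
      constructor
      · exact fun h => ⟨f, h, rfl⟩
      · rintro ⟨g, hg, h⟩
        rwa [← hinj h]
    rw [h1, hmem]
    constructor
    · intro h x hx
      rw [mem_ker, ← forall_dual_apply_eq_zero_iff F]
      intro γ
      exact (Submodule.mem_dualCoannihilator _).1 hx _ (h ⟨γ, rfl⟩)
    · rintro h _ ⟨γ, rfl⟩
      rw [← Subspace.dualCoannihilator_dualAnnihilator_eq (W := V),
        Submodule.mem_dualAnnihilator]
      intro x hx
      have : f x = 0 := h hx
      simp [Module.Dual.transpose_apply, this]

/-! ### The square case -/

/-- An injective linear map can be prescribed at a vector and made to avoid another one. -/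
theorem exists_injective_apply_eq_notMem_range {Q : Type*} [AddCommGroup Q] [Module F Q]
    [FiniteDimensional F Q] (hQ : finrank F Q < finrank F G) {u : Q} (hu : u ≠ 0) {g w : G}
    (hg : g ≠ 0) (hw : w ∉ Submodule.span F {g}) :
    ∃ f : Q →ₗ[F] G, Function.Injective f ∧ f u = g ∧ w ∉ range f := by
  -- Mapping into the hyperplane ker χ, which contains g but not w, ensures that w is avoided; an
  -- automorphism of ker χ then moves the image of u to g.
  obtain ⟨χ, hχw, hχ⟩ := Submodule.exists_le_ker_of_notMem hw
  have hχg : g ∈ ker χ := hχ (Submodule.mem_span_singleton_self g)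
  have hχ0 : χ ≠ 0 := by rintro rfl; simp at hχw
  have hker := Module.Dual.finrank_ker_add_one_of_ne_zero hχ0
  obtain ⟨j, hj⟩ : ∃ j : Q →ₗ[F] ker χ, Function.Injective j := by
    rw [← lift_rank_le_iff_exists_linearMap, ← finrank_eq_rank, ← finrank_eq_rank,
      Cardinal.lift_natCast, Cardinal.lift_natCast, Nat.cast_le]
    omega
  have hju : j u ≠ 0 := fun h => hu (hj (by rw [h, map_zero]))
  have hg' : (⟨g, hχg⟩ : ker χ) ≠ 0 := fun h => hg (congrArg Subtype.val h)
  obtain ⟨e, he⟩ := Submodule.exists_linearEquiv_restrict_eq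
    ((LinearEquiv.toSpanNonzeroSingleton F (ker χ) (j u) hju).symm ≪≫ₗ
      LinearEquiv.toSpanNonzeroSingleton F (ker χ) ⟨g, hχg⟩ hg')
  have heu : e (j u) = ⟨g, hχg⟩ := by
    have h1 := he ⟨j u, Submodule.mem_span_singleton_self _⟩
    have h2 : (LinearEquiv.toSpanNonzeroSingleton F (ker χ) (j u) hju).symm
        ⟨j u, Submodule.mem_span_singleton_self _⟩ = 1 := by
      rw [LinearEquiv.symm_apply_eq, LinearEquiv.toSpanNonzeroSingleton_one]
    rw [← h1, LinearEquiv.trans_apply, h2, LinearEquiv.toSpanNonzeroSingleton_one]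
  refine ⟨(ker χ).subtype ∘ₗ e.toLinearMap ∘ₗ j,
    Subtype.val_injective.comp (e.injective.comp hj), by simp [heu], ?_⟩
  rintro ⟨x, rfl⟩
  exact hχw (e (j x)).2

/-- If a linear map sends every injective map to a vector in its range, then it sends rank-one
maps to vectors in their range. -/
theorem apply_smulRight_mem_span {Q : Type*} [AddCommGroup Q] [Module F Q]
    [FiniteDimensional F Q] (hQ : finrank F Q < finrank F G) (θ : (Q →ₗ[F] G) →ₗ[F] G)
    (hθ : ∀ f : Q →ₗ[F] G, Function.Injective f → θ f ∈ range f) (ψ : Dual F Q) (g : G) :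
    θ (ψ.smulRight g) ∈ Submodule.span F {g} := by
  by_cases hg : g = 0
  · subst hg
    simp
  by_cases hψ : ∃ u, u ≠ 0 ∧ ψ u = 0
  · obtain ⟨u, hu, hψu⟩ := hψ
    by_contra hw
    obtain ⟨f, hf, hfu, hfw⟩ := exists_injective_apply_eq_notMem_range hQ hu hg hw
    -- As f u = g, this map is f composed with the transvection x ↦ x + ψ(x)u, which is injective
    -- because ψ u = 0. Both maps have their `θ`-value in range f, hence so does the difference.
    have hinj : Function.Injective (f + ψ.smulRight g) := by
      rw [injective_iff_map_eq_zero]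
      intro x hx
      have h1 : x + ψ x • u = 0 := hf (by simpa [hfu] using hx)
      have h2 : ψ x = 0 := by simpa [hψu] using congrArg ψ h1
      simpa [h2] using h1
    have hrange : range (f + ψ.smulRight g) ≤ range f := by
      rintro _ ⟨x, rfl⟩
      exact ⟨x + ψ x • u, by simp [hfu]⟩
    apply hfw
    have := Submodule.sub_mem _ (hrange (hθ _ hinj)) (hθ _ hf)
    simpa using this
  · push Not at hψ
    have hinj : Function.Injective (ψ.smulRight g) := by
      rw [injective_iff_map_eq_zero]
      intro x hx
      by_contra hx0
      exact (smul_ne_zero (hψ x hx0) hg) hx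
    have := hθ _ hinj
    obtain ⟨x, hx⟩ := this
    rw [← hx]
    exact Submodule.mem_span_singleton.2 ⟨ψ x, rfl⟩

/-- The square case, when all multiples of one linear form lie in the space. -/
theorem exists_le_ker_of_rankOneSpace_eq_top {r : ℕ} (hGE : finrank F G = finrank F E)
    (hr : r < finrank F G) (A : Submodule F (E →ₗ[F] G))
    (hA : ∀ f ∈ A, finrank F (range f) ≤ r) (hdim : finrank F A = finrank F E * r)
    {φ : Dual F E} (hφ : φ ≠ 0) (htop : rankOneSpace A φ = ⊤) :
    ∃ K : Submodule F E, finrank F K + r = finrank F E ∧ ∀ f ∈ A, K ≤ ker f := by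
  obtain ⟨y, hy⟩ := exists_apply_eq_one hφ
  have hker := Module.Dual.finrank_ker_add_one_of_ne_zero hφ
  let res : (E →ₗ[F] G) →ₗ[F] (ker φ →ₗ[F] G) := lcomp F G (ker φ).subtype
  -- All φ ⊗ g lie in `A`, so the value of f at y may be changed freely; a value outside the range
  -- of the restriction adds one to the rank.
  have hrank : ∀ f ∈ A, finrank F (range (res f)) + 1 ≤ r := by
    intro f hf
    have hle : range (res f) ≤ range f := by
      rintro _ ⟨x, rfl⟩
      exact ⟨x, rfl⟩
    obtain ⟨g, hg⟩ : ∃ g, g ∉ range (res f) := by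
      by_contra! hk
      have h1 : range (res f) = ⊤ := (Submodule.eq_top_iff'.2 hk)
      have h2 := Submodule.finrank_mono hle
      rw [h1, finrank_top] at h2
      have := hA f hf
      omega
    have hmem : φ.smulRight (g - f y) ∈ A := by
      rw [← mem_rankOneSpace, htop]
      trivial
    have h1 : range (res f) ⊔ Submodule.span F {g} ≤ range (f + φ.smulRight (g - f y)) := by
      refine sup_le ?_ ((Submodule.span_singleton_le_iff_mem _ _).2 ⟨y, by simp [hy]⟩)
      rintro _ ⟨x, rfl⟩
      exact ⟨x, by simp [res, mem_ker.1 x.2]⟩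
    have h2 : finrank F (range (res f)) <
        finrank F (range (res f) ⊔ Submodule.span F {g} : Submodule F G) := by
      apply Submodule.finrank_lt_finrank_of_lt
      refine lt_of_le_of_ne le_sup_left fun he => hg ?_
      rw [he]
      exact Submodule.mem_sup_right (Submodule.mem_span_singleton_self g)
    have h3 := Submodule.finrank_mono h1
    have h4 := hA _ (A.add_mem hf hmem)
    omega
  have hr1 : 1 ≤ r := (Nat.le_add_left _ _).trans (hrank 0 A.zero_mem)
  have hdimres : finrank F G * (r - 1) ≤ finrank F (A.map res) := by
    have h1 := finrank_range_add_finrank_ker (res.domRestrict A)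
    rw [range_domRestrict] at h1
    have h2 : finrank F (ker (res.domRestrict A)) ≤ finrank F G := by
      refine finrank_le_finrank_of_injective (f := (applyₗ y ∘ₗ A.subtype) ∘ₗ
        (ker (res.domRestrict A)).subtype) ?_
      rw [injective_iff_map_eq_zero]
      rintro ⟨⟨f, hf⟩, hf0⟩ hfy
      have h3 := eq_smulRight_of_ker_le (f := f) hy
        fun x hx => LinearMap.congr_fun (mem_ker.1 hf0) (⟨x, hx⟩ : ker φ)
      have h4 : f y = 0 := hfy
      rw [h4, smulRight_zero] at h3
      ext1; ext1
      exact h3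
    obtain ⟨s, rfl⟩ := Nat.exists_eq_add_of_le hr1
    rw [hdim, ← hGE, Nat.mul_add, Nat.mul_one] at h1
    rw [Nat.add_sub_cancel_left]
    omega
  -- The domain ker φ is now smaller than `G`. The codimension of `K` is r - 1 in ker φ, hence r in
  -- `E`.
  obtain ⟨K, hK, hKmem⟩ := exists_forall_mem_iff_le_ker (r := r - 1) (by omega) (by omega)
    (A.map res) (by
      rintro _ ⟨f, hf, rfl⟩
      have := hrank f hf
      omega) hdimres
  refine ⟨K.map (ker φ).subtype, ?_, ?_⟩
  · rw [Submodule.finrank_map_subtype_eq]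
    omega
  · rintro f hf _ ⟨x, hx, rfl⟩
    exact (hKmem (res f)).1 ⟨f, hf, rfl⟩ hx

/-- The square case, when no multiple of some linear form lies in the space. -/
theorem exists_rankOneSpace_eq_top_of_eq_bot {r : ℕ} (hGE : finrank F G = finrank F E)
    (hr : r < finrank F G) (hr1 : 1 ≤ r) (A : Submodule F (E →ₗ[F] G))
    (hA : ∀ f ∈ A, finrank F (range f) ≤ r) (hdim : finrank F A = finrank F E * r)
    {φ : Dual F E} (hφ : φ ≠ 0) (hbot : rankOneSpace A φ = ⊥) :
    ∃ ψ : Dual F E, ψ ≠ 0 ∧ rankOneSpace A ψ = ⊤ := by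
  obtain ⟨y, hy⟩ := exists_apply_eq_one hφ
  have hker := Module.Dual.finrank_ker_add_one_of_ne_zero hφ
  let res : (E →ₗ[F] G) →ₗ[F] (ker φ →ₗ[F] G) := lcomp F G (ker φ).subtype
  have hinj : ker (res.domRestrict A) = ⊥ := by
    rw [Submodule.eq_bot_iff]
    rintro ⟨f, hf⟩ hf0
    have h1 := eq_smulRight_of_ker_le (f := f) hy
      fun x hx => LinearMap.congr_fun (mem_ker.1 hf0) (⟨x, hx⟩ : ker φ)
    have h2 : f y ∈ rankOneSpace A φ := by rwa [mem_rankOneSpace, ← h1]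
    rw [hbot, Submodule.mem_bot] at h2
    rw [h2, smulRight_zero] at h1
    ext1
    exact h1
  have hdimres : finrank F G * r ≤ finrank F (A.map res) := by
    have h1 := finrank_range_add_finrank_ker (res.domRestrict A)
    rw [range_domRestrict, hinj, finrank_bot] at h1
    rw [hGE, ← hdim]
    omega
  have hle : ∀ f, range (res f) ≤ range f := by
    rintro f _ ⟨x, rfl⟩
    exact ⟨x, rfl⟩
  obtain ⟨K, hK, hKmem⟩ := exists_forall_mem_iff_le_ker (r := r) (by omega) (by omega)
    (A.map res) (by
      rintro _ ⟨f, hf, rfl⟩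
      exact (Submodule.finrank_mono (hle f)).trans (hA f hf)) hdimres
  -- On maps that vanish on `K`, `ℓ` gives the unique extension lying in `A`; below, `θ` records its
  -- value at y.
  obtain ⟨ℓ, hℓ⟩ := exists_leftInverse_of_injective _ hinj
  have hext : ∀ h : (ker φ ⧸ K) →ₗ[F] G, res (ℓ (h ∘ₗ K.mkQ)) = h ∘ₗ K.mkQ := by
    intro h
    have h1 : h ∘ₗ K.mkQ ∈ A.map res := by
      rw [hKmem]
      intro x hx
      simp [(Submodule.Quotient.mk_eq_zero K).2 hx]
    obtain ⟨f, hf, hfe⟩ := h1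
    have h2 := LinearMap.congr_fun hℓ ⟨f, hf⟩
    rw [← hfe]
    have h3 : ℓ (res f) = ⟨f, hf⟩ := h2
    rw [h3]
  let θ : ((ker φ ⧸ K) →ₗ[F] G) →ₗ[F] G := applyₗ y ∘ₗ A.subtype ∘ₗ ℓ ∘ₗ lcomp F G K.mkQ
  have hQ : finrank F (ker φ ⧸ K) = r := by
    have := Submodule.finrank_quotient_add_finrank K
    omega
  -- An injective h already has rank r, so the extension, of rank at most r, gains no new range.
  have hθ : ∀ h : (ker φ ⧸ K) →ₗ[F] G, Function.Injective h → θ h ∈ range h := by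
    intro h hh
    have h1 : range h ≤ range (ℓ (h ∘ₗ K.mkQ) : E →ₗ[F] G) := by
      have h2 := hle (ℓ (h ∘ₗ K.mkQ))
      rw [hext h, range_comp_of_range_eq_top _ K.range_mkQ] at h2
      exact h2
    have h3 : range h = range (ℓ (h ∘ₗ K.mkQ) : E →ₗ[F] G) := by
      refine Submodule.eq_of_le_of_finrank_le h1 ?_
      rw [finrank_range_of_inj hh, hQ]
      exact hA _ (ℓ (h ∘ₗ K.mkQ)).2
    rw [h3]
    exact ⟨y, rfl⟩
  obtain ⟨q, hq⟩ : ∃ q : ker φ ⧸ K, q ≠ 0 := by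
    have : Nontrivial (ker φ ⧸ K) := nontrivial_of_finrank_pos (R := F) (by omega)
    exact exists_ne 0
  obtain ⟨ψ, hψ⟩ : ∃ ψ : Dual F (ker φ ⧸ K), ψ q ≠ 0 := by
    by_contra! hk
    exact hq ((forall_dual_apply_eq_zero_iff F q).1 hk)
  -- The map g ↦ θ(ψ ⊗ g) sends every g into its own line, so it is a scalar c.
  obtain ⟨c, hc⟩ := exists_eq_smul_id_of_forall_notLinearIndependent
    (f := θ ∘ₗ smulRightₗ ψ) (by
      intro g hg
      obtain ⟨a, ha⟩ := Submodule.mem_span_singleton.1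
        (apply_smulRight_mem_span (by omega) θ hθ ψ g)
      have h1 := (LinearIndependent.pair_iff.1 hg) a (-1) (by
        rw [ha]; simp)
      simp at h1)
  -- the extension of `ψ` to `E` that takes the value `c` at `y`
  let π : E →ₗ[F] ker φ := (LinearMap.id - φ.smulRight y).codRestrict (ker φ) (by
    intro x; simp [hy])
  have hπval : ∀ x, (π x : E) = x - φ x • y := fun _ => rfl
  have hπ : ∀ x : ker φ, π x = x := fun x => by
    ext1
    rw [hπval, mem_ker.1 x.2, zero_smul, sub_zero]
  refine ⟨ψ ∘ₗ K.mkQ ∘ₗ π + c • φ, ?_, ?_⟩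
  · intro h0
    obtain ⟨x, rfl⟩ := K.mkQ_surjective q
    have := LinearMap.congr_fun h0 (x : E)
    simp only [add_apply, comp_apply, hπ, smul_apply, mem_ker.1 x.2, smul_zero, add_zero,
      zero_apply] at this
    exact hψ this
  · rw [Submodule.eq_top_iff']
    intro g
    rw [mem_rankOneSpace]
    have h1 := hext (ψ.smulRight g)
    have h2 : (ℓ ((ψ.smulRight g) ∘ₗ K.mkQ) : E →ₗ[F] G) y = c • g :=
      LinearMap.congr_fun hc g
    convert (ℓ ((ψ.smulRight g) ∘ₗ K.mkQ)).2 using 1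
    ext x
    have hx : x = (π x : E) + φ x • y := by rw [hπval, sub_add_cancel]
    have h3 := LinearMap.congr_fun h1 (π x)
    conv_rhs => rw [hx, map_add, map_smul, h2]
    have h4 : (ℓ ((ψ.smulRight g) ∘ₗ K.mkQ) : E →ₗ[F] G) (π x) = ψ (K.mkQ (π x)) • g := h3
    rw [h4]
    simp [add_smul, smul_smul, mul_comm]

/-- A space of linear maps of rank at most `r` of the maximal possible dimension consists of maps
into a subspace of dimension at most `r` or, in the square case, of maps that vanish on a subspace
of codimension at most `r`. -/
theorem exists_range_le_or_exists_le_ker {r : ℕ}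
    (hGE : finrank F G ≤ finrank F E) (A : Submodule F (E →ₗ[F] G))
    (hA : ∀ f ∈ A, finrank F (range f) ≤ r) (hdim : finrank F A = finrank F E * r) :
    (∃ V : Submodule F G, finrank F V ≤ r ∧ ∀ f ∈ A, range f ≤ V) ∨
    (finrank F G = finrank F E ∧
      ∃ K : Submodule F E, finrank F E ≤ finrank F K + r ∧ ∀ f ∈ A, K ≤ ker f) := by
  rcases lt_or_ge r (finrank F G) with hr | hr
  swap
  · exact Or.inl ⟨⊤, by rwa [finrank_top], fun _ _ => le_top⟩
  rcases Nat.eq_zero_or_pos r with h0 | hr1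
  · refine Or.inl ⟨⊥, by simp, fun f hf => ?_⟩
    have := hA f hf
    rw [h0, Nat.le_zero, Submodule.finrank_eq_zero] at this
    exact this.le
  have htop : ∀ φ : Dual F E, φ ≠ 0 → finrank F G = finrank F E → rankOneSpace A φ = ⊤ →
      ∃ K : Submodule F E, finrank F E ≤ finrank F K + r ∧ ∀ f ∈ A, K ≤ ker f := by
    intro φ hφ hsq h
    obtain ⟨K, hK, hK'⟩ := exists_le_ker_of_rankOneSpace_eq_top hsq hr A hA hdim hφ h
    exact ⟨K, hK.ge, hK'⟩
  by_cases hall : ∀ φ : Dual F E, φ ≠ 0 → finrank F (rankOneSpace A φ) = r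
  · obtain ⟨V, hV, hmem⟩ :=
      exists_forall_mem_iff_range_le_of_finrank_rankOneSpace hGE hr A hA hdim hall
    exact Or.inl ⟨V, hV.le, fun f hf => (hmem f).1 hf⟩
  · push Not at hall
    obtain ⟨φ, hφ, hne⟩ := hall
    rcases finrank_rankOneSpace_trichotomy hGE hr A hA hdim hφ with h | ⟨hsq, h | h⟩
    · exact absurd h hne
    · obtain ⟨ψ, hψ, hψt⟩ := exists_rankOneSpace_eq_top_of_eq_bot hsq hr hr1 A hA hdim hφ h
      exact Or.inr ⟨hsq, htop ψ hψ hsq hψt⟩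
    · exact Or.inr ⟨hsq, htop φ hφ hsq h⟩

end LinearMap

/-! ### Flats of maximal dimension -/

namespace QPolymatroid

open Module

variable {F E : Type*} [Field F] [AddCommGroup E] [Module F E] [FiniteDimensional F E]

/-- A largest subspace of rank at most `rho ⊤ - t` is a flat. -/
theorem exists_isFlat_forall_finrank_le (M : QPolymatroid F E) {t : ℚ}
    (h : M.rho ⊥ ≤ M.rho ⊤ - t) :
    ∃ V, M.IsFlat V ∧ M.rho V ≤ M.rho ⊤ - t ∧
      ∀ W, M.rho W ≤ M.rho ⊤ - t → finrank F W ≤ finrank F V := by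
  -- The maximum is taken over all subspaces of small rank, not only over flats.
  let S : Set ℕ := {d | ∃ V : Submodule F E, M.rho V ≤ M.rho ⊤ - t ∧ finrank F V = d}
  have hbdd : BddAbove S := ⟨finrank F E, by
    rintro _ ⟨V, -, rfl⟩
    exact Submodule.finrank_le V⟩
  obtain ⟨V, hV, hVd⟩ := Nat.sSup_mem (s := S) ⟨_, ⊥, h, rfl⟩ hbdd
  have hmax : ∀ W, M.rho W ≤ M.rho ⊤ - t → finrank F W ≤ finrank F V := fun W hW =>
    (le_csSup hbdd ⟨W, hW, rfl⟩).trans_eq hVd.symm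
  refine ⟨V, fun x hx => ?_, hV, hmax⟩
  by_contra! hle
  have h1 : finrank F V < finrank F (V ⊔ Submodule.span F {x} : Submodule F E) := by
    apply Submodule.finrank_lt_finrank_of_lt
    refine lt_of_le_of_ne le_sup_left fun he => hx ?_
    rw [he]
    exact Submodule.mem_sup_right (Submodule.mem_span_singleton_self x)
  exact absurd (hmax _ (hle.trans hV)) (not_le.2 h1)

theorem isGreatest_flatDims (M : QPolymatroid F E) {t : ℚ} {V : Submodule F E}
    (hV : M.IsFlat V) (hVt : M.rho V ≤ M.rho ⊤ - t)
    (hmax : ∀ W, M.rho W ≤ M.rho ⊤ - t → finrank F W ≤ finrank F V) :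
    IsGreatest (M.flatDims t) (finrank F V) := by
  refine ⟨⟨V, hV, hVt, rfl⟩, ?_⟩
  rintro _ ⟨W, -, hW, rfl⟩
  exact hmax W hW

end QPolymatroid

/-! ### Orthogonality and the weights as minimal dimensions -/

namespace RankMetric

open Module Matrix

variable {F : Type*} [Field F] {n m : ℕ}

/-- The standard dot product as a bilinear form. -/
noncomputable def dotForm (F : Type*) [Field F] (l : ℕ) : LinearMap.BilinForm F (Fin l → F) :=
  dotProductBilin F F

theorem perp_eq_orthogonal {l : ℕ} (V : Submodule F (Fin l → F)) :
    perp V = (dotForm F l).orthogonal V := rfl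

theorem isRefl_dotForm (l : ℕ) :
    (dotForm F l).IsRefl := fun v w h => by
  exact (dotProduct_comm w v).trans h

theorem nondegenerate_dotForm (l : ℕ) :
    (dotForm F l).Nondegenerate := by
  have h : ∀ v : Fin l → F, (∀ w, dotForm F l v w = 0) → v = 0 := dotProduct_eq_zero
  exact ⟨h, fun v hv => h v fun w => isRefl_dotForm l w v (hv w)⟩

theorem finrank_perp {l : ℕ} (V : Submodule F (Fin l → F)) :
    finrank F V + finrank F (perp V) = l := by
  have h := LinearMap.BilinForm.finrank_orthogonal (nondegenerate_dotForm l) V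
  have h2 := Submodule.finrank_le V
  rw [finrank_fin_fun] at h h2
  rw [perp_eq_orthogonal, h]
  omega

theorem perp_perp {l : ℕ} (V : Submodule F (Fin l → F)) : perp (perp V) = V := by
  rw [perp_eq_orthogonal, perp_eq_orthogonal]
  exact LinearMap.BilinForm.orthogonal_orthogonal (nondegenerate_dotForm l)
    (isRefl_dotForm l) V

theorem perp_top (l : ℕ) : perp (⊤ : Submodule F (Fin l → F)) = ⊥ := by
  have h := finrank_perp (⊤ : Submodule F (Fin l → F))
  rw [finrank_top, finrank_fin_fun] at h
  exact Submodule.finrank_eq_zero.1 (by omega)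

theorem perp_bot (l : ℕ) : perp (⊥ : Submodule F (Fin l → F)) = ⊤ := by
  rw [← perp_top, perp_perp]

theorem shortenCol_bot (C : Submodule F (Matrix (Fin n) (Fin m) F)) : shortenCol C ⊥ = ⊥ := by
  rw [Submodule.eq_bot_iff]
  intro M hM
  ext i j
  exact congrFun ((colsp_le_iff _ _).1 hM.2 j) i

theorem shortenCol_top (C : Submodule F (Matrix (Fin n) (Fin m) F)) : shortenCol C ⊤ = C :=
  le_antisymm (fun _ h => h.1) fun _ h => ⟨h, le_top⟩

theorem shortenRow_bot (C : Submodule F (Matrix (Fin n) (Fin m) F)) : shortenRow C ⊥ = ⊥ := by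
  rw [Submodule.eq_bot_iff]
  intro M hM
  ext i j
  exact congrFun ((rowsp_le_iff _ _).1 hM.2 i) j

theorem shortenRow_top (C : Submodule F (Matrix (Fin n) (Fin m) F)) : shortenRow C ⊤ = C :=
  le_antisymm (fun _ h => h.1) fun _ h => ⟨h, le_top⟩

/-- Since ⊤^⊥ = 0, the rank of ⊤ is `dim C / m`, and both sides can be compared after clearing m. -/
theorem colPM_rho_le_iff (hm : 0 < m) (C : Submodule F (Matrix (Fin n) (Fin m) F)) (i : ℕ)
    (V : Submodule F (Fin n → F)) :
    (colPM C).rho V ≤ (colPM C).rho ⊤ - (i : ℚ) / m ↔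
      i ≤ finrank F (shortenCol C (perp V)) := by
  have hm' : (0 : ℚ) < m := by exact_mod_cast hm
  have h0 : finrank F (shortenCol C (perp ⊤)) = 0 := by
    rw [perp_top, shortenCol_bot, finrank_bot]
  simp only [colPM]
  rw [h0, Nat.cast_zero, sub_zero, ← sub_div, div_le_div_iff_of_pos_right hm', sub_le_sub_iff_left, Nat.cast_le]

theorem rowPM_rho_le_iff (hn : 0 < n) (C : Submodule F (Matrix (Fin n) (Fin m) F)) (i : ℕ)
    (W : Submodule F (Fin m → F)) :
    (rowPM C).rho W ≤ (rowPM C).rho ⊤ - (i : ℚ) / n ↔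
      i ≤ finrank F (shortenRow C (perp W)) := by
  have hn' : (0 : ℚ) < n := by exact_mod_cast hn
  have h0 : finrank F (shortenRow C (perp ⊤)) = 0 := by
    rw [perp_top, shortenRow_bot, finrank_bot]
  simp only [rowPM]
  rw [h0, Nat.cast_zero, sub_zero, ← sub_div, div_le_div_iff_of_pos_right hn', sub_le_sub_iff_left, Nat.cast_le]

/-- `b_i^c(C)` is the least dimension of a space `U` such that `dim C(U, c) ≥ i`. -/
theorem exists_flatWeightCol_eq (hm : 0 < m) (C : Submodule F (Matrix (Fin n) (Fin m) F)) {i : ℕ}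
    (hi : i ≤ finrank F C) :
    ((colPM C).flatDims ((i : ℚ) / m)).Nonempty ∧ ∃ U : Submodule F (Fin n → F),
      i ≤ finrank F (shortenCol C U) ∧ flatWeightCol C i = finrank F U ∧
      ∀ U', i ≤ finrank F (shortenCol C U') → finrank F U ≤ finrank F U' := by
  obtain ⟨V, hflat, hV, hmax⟩ := (colPM C).exists_isFlat_forall_finrank_le
    (t := (i : ℚ) / m) (by rw [colPM_rho_le_iff hm, perp_bot, shortenCol_top]; exact hi)
  have hG := (colPM C).isGreatest_flatDims hflat hV hmax
  have hd := finrank_perp V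
  refine ⟨⟨_, hG.1⟩, perp V, (colPM_rho_le_iff hm C i V).1 hV, ?_, fun U' hU' => ?_⟩
  · rw [flatWeightCol, hG.csSup_eq]
    nth_rewrite 1 [← hd]
    push_cast
    ring
  · have h1 := hmax (perp U') (by rw [colPM_rho_le_iff hm, perp_perp]; exact hU')
    have h2 := finrank_perp U'
    omega

/-- `b_i^r(C)` is the least dimension of a space `U` such that `dim C(U, r) ≥ i`. -/
theorem exists_flatWeightRow_eq (hn : 0 < n) (C : Submodule F (Matrix (Fin n) (Fin m) F)) {i : ℕ}
    (hi : i ≤ finrank F C) :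
    ((rowPM C).flatDims ((i : ℚ) / n)).Nonempty ∧ ∃ U : Submodule F (Fin m → F),
      i ≤ finrank F (shortenRow C U) ∧ flatWeightRow C i = finrank F U ∧
      ∀ U', i ≤ finrank F (shortenRow C U') → finrank F U ≤ finrank F U' := by
  obtain ⟨V, hflat, hV, hmax⟩ := (rowPM C).exists_isFlat_forall_finrank_le
    (t := (i : ℚ) / n) (by rw [rowPM_rho_le_iff hn, perp_bot, shortenRow_top]; exact hi)
  have hG := (rowPM C).isGreatest_flatDims hflat hV hmax
  have hd := finrank_perp V
  refine ⟨⟨_, hG.1⟩, perp V, (rowPM_rho_le_iff hn C i V).1 hV, ?_, fun U' hU' => ?_⟩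
  · rw [flatWeightRow, hG.csSup_eq]
    nth_rewrite 1 [← hd]
    push_cast
    ring
  · have h1 := hmax (perp U') (by rw [rowPM_rho_le_iff hn, perp_perp]; exact hU')
    have h2 := finrank_perp U'
    omega

/-! ### Optimal and standard anticodes -/

theorem rank_eq_finrank_colsp (M : Matrix (Fin n) (Fin m) F) : M.rank = finrank F (colsp M) :=
  M.rank_eq_finrank_span_cols

theorem rank_eq_finrank_rowsp (M : Matrix (Fin n) (Fin m) F) : M.rank = finrank F (rowsp M) :=
  M.rank_eq_finrank_span_row

theorem rank_le_maxrk {A : Submodule F (Matrix (Fin n) (Fin m) F)}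
    {M : Matrix (Fin n) (Fin m) F} (hM : M ∈ A) : M.rank ≤ maxrk A := by
  refine le_csSup ⟨n, ?_⟩ ⟨M, hM, rfl⟩
  rintro _ ⟨N, -, rfl⟩
  simpa using N.rank_le_card_height

theorem maxrk_le {A : Submodule F (Matrix (Fin n) (Fin m) F)} {r : ℕ}
    (h : ∀ M ∈ A, M.rank ≤ r) : maxrk A ≤ r := by
  refine csSup_le ⟨_, 0, A.zero_mem, rfl⟩ ?_
  rintro _ ⟨M, hM, rfl⟩
  exact h M hM

/-- The linear maps given by the matrices of a code. -/
noncomputable def toMaps (A : Submodule F (Matrix (Fin n) (Fin m) F)) :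
    Submodule F ((Fin m → F) →ₗ[F] (Fin n → F)) :=
  A.map (toLin' : Matrix (Fin n) (Fin m) F ≃ₗ[F] _).toLinearMap

theorem finrank_toMaps (A : Submodule F (Matrix (Fin n) (Fin m) F)) :
    finrank F (toMaps A) = finrank F A :=
  LinearEquiv.finrank_map_eq _ A

theorem finrank_range_le_maxrk (A : Submodule F (Matrix (Fin n) (Fin m) F)) :
    ∀ f ∈ toMaps A, finrank F (LinearMap.range f) ≤ maxrk A := by
  rintro _ ⟨M, hM, rfl⟩
  exact rank_le_maxrk hM

theorem finrank_le_mul_maxrk (hnm : n ≤ m) (A : Submodule F (Matrix (Fin n) (Fin m) F)) :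
    finrank F A ≤ m * maxrk A := by
  have h := LinearMap.finrank_le_mul_of_forall_finrank_range_le (by simpa using hnm) (toMaps A)
    (finrank_range_le_maxrk A)
  rwa [finrank_toMaps, finrank_fin_fun] at h

/-- Optimal anticodes are contained in standard ones. -/
theorem IsOptimalAnticode.colsp_le_or_rowsp_le (hnm : n ≤ m)
    {A : Submodule F (Matrix (Fin n) (Fin m) F)} (hA : IsOptimalAnticode A) :
    (∃ V : Submodule F (Fin n → F), finrank F V ≤ maxrk A ∧ ∀ M ∈ A, colsp M ≤ V) ∨
    (n = m ∧ ∃ W : Submodule F (Fin m → F), finrank F W ≤ maxrk A ∧ ∀ M ∈ A, rowsp M ≤ W) := by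
  rcases LinearMap.exists_range_le_or_exists_le_ker (by simpa using hnm) (toMaps A)
    (finrank_range_le_maxrk A) (by rw [finrank_toMaps, finrank_fin_fun]; exact hA) with
    ⟨V, hV, h⟩ | ⟨hsq, K, hK, h⟩
  · refine Or.inl ⟨V, hV, fun M hM => ?_⟩
    have := h _ ⟨M, hM, rfl⟩
    rwa [LinearEquiv.coe_coe, range_toLin'] at this
  -- A matrix kills `K` exactly when its rows are orthogonal to `K`.
  · refine Or.inr ⟨by simpa using hsq, perp K, ?_, fun M hM => ?_⟩
    · have := finrank_perp K
      rw [finrank_fin_fun] at hK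
      omega
    · rw [rowsp_le_iff]
      intro i v hv
      have h1 : M *ᵥ v = 0 := h _ ⟨M, hM, rfl⟩ hv
      rw [dotProduct_comm]
      exact congrFun h1 i

/-- The bound `rho ≤ dim` for the full matrix space at `perp U` gives dimension at least `m * dim
U`. As `maxrk` is at most `dim U`, the bound `m * maxrk` forces equality throughout. -/
theorem isOptimalAnticode_shortenCol (hnm : n ≤ m) (U : Submodule F (Fin n → F)) :
    IsOptimalAnticode (shortenCol (⊤ : Submodule F (Matrix (Fin n) (Fin m) F)) U) ∧
      finrank F (shortenCol (⊤ : Submodule F (Matrix (Fin n) (Fin m) F)) U) =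
        m * finrank F U := by
  have h1 := finrank_le_mul_maxrk hnm (shortenCol (⊤ : Submodule F (Matrix (Fin n) (Fin m) F)) U)
  have h2 : maxrk (shortenCol (⊤ : Submodule F (Matrix (Fin n) (Fin m) F)) U) ≤ finrank F U :=
    maxrk_le fun M hM => by
      rw [rank_eq_finrank_colsp]
      exact Submodule.finrank_mono hM.2
  have h3 : m * finrank F U ≤
      finrank F (shortenCol (⊤ : Submodule F (Matrix (Fin n) (Fin m) F)) U) := by
    have h4 := (isQRankFunction_col (⊤ : Submodule F (Matrix (Fin n) (Fin m) F))).le_dim (perp U)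
    have h5 := finrank_perp U
    rcases Nat.eq_zero_or_pos m with h0 | h0
    · simp [h0]
    have hm' : (0 : ℚ) < m := by exact_mod_cast h0
    rw [perp_perp, div_le_iff₀ hm', finrank_top, finrank_matrix, finrank_self] at h4
    simp only [Fintype.card_fin, mul_one] at h4
    have h6 : (finrank F U : ℚ) + finrank F (perp U) = n := by exact_mod_cast h5
    have h7 : (m : ℚ) * finrank F U ≤
        finrank F (shortenCol (⊤ : Submodule F (Matrix (Fin n) (Fin m) F)) U) := by
      push_cast at h4
      rw [← h6] at h4
      linarith
    exact_mod_cast h7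
  have h8 := Nat.mul_le_mul_left m h2
  exact ⟨by unfold IsOptimalAnticode; omega, by omega⟩

/-- The argument for columns gives dimension `n * dim U`; squareness makes this the `m * dim U` that
optimality demands. -/
theorem isOptimalAnticode_shortenRow (hnm : n = m) (U : Submodule F (Fin m → F)) :
    IsOptimalAnticode (shortenRow (⊤ : Submodule F (Matrix (Fin n) (Fin m) F)) U) ∧
      finrank F (shortenRow (⊤ : Submodule F (Matrix (Fin n) (Fin m) F)) U) =
        m * finrank F U := by
  subst hnm
  have h1 := finrank_le_mul_maxrk le_rfl
    (shortenRow (⊤ : Submodule F (Matrix (Fin n) (Fin n) F)) U)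
  have h2 : maxrk (shortenRow (⊤ : Submodule F (Matrix (Fin n) (Fin n) F)) U) ≤ finrank F U :=
    maxrk_le fun M hM => by
      rw [rank_eq_finrank_rowsp]
      exact Submodule.finrank_mono hM.2
  have h3 : n * finrank F U ≤
      finrank F (shortenRow (⊤ : Submodule F (Matrix (Fin n) (Fin n) F)) U) := by
    have h4 := (isQRankFunction_row (⊤ : Submodule F (Matrix (Fin n) (Fin n) F))).le_dim (perp U)
    have h5 := finrank_perp U
    rcases Nat.eq_zero_or_pos n with h0 | h0
    · simp [h0]
    have hm' : (0 : ℚ) < n := by exact_mod_cast h0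
    rw [perp_perp, div_le_iff₀ hm', finrank_top, finrank_matrix, finrank_self] at h4
    simp only [Fintype.card_fin, mul_one] at h4
    have h6 : (finrank F U : ℚ) + finrank F (perp U) = n := by exact_mod_cast h5
    have h7 : (n : ℚ) * finrank F U ≤
        finrank F (shortenRow (⊤ : Submodule F (Matrix (Fin n) (Fin n) F)) U) := by
      push_cast at h4
      nlinarith
    exact_mod_cast h7
  have h8 := Nat.mul_le_mul_left n h2
  exact ⟨by unfold IsOptimalAnticode; omega, by omega⟩

theorem inf_shortenCol_top (C : Submodule F (Matrix (Fin n) (Fin m) F))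
    (U : Submodule F (Fin n → F)) : C ⊓ shortenCol ⊤ U = shortenCol C U :=
  le_antisymm (fun _ h => ⟨h.1, h.2.2⟩) fun _ h => ⟨h.1, trivial, h.2⟩

theorem inf_shortenRow_top (C : Submodule F (Matrix (Fin n) (Fin m) F))
    (U : Submodule F (Fin m → F)) : C ⊓ shortenRow ⊤ U = shortenRow C U :=
  le_antisymm (fun _ h => ⟨h.1, h.2.2⟩) fun _ h => ⟨h.1, trivial, h.2⟩

theorem mem_anticodeDims_of_shortenCol (hnm : n ≤ m)
    {C : Submodule F (Matrix (Fin n) (Fin m) F)} {i : ℕ} {U : Submodule F (Fin n → F)}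
    (hU : i ≤ finrank F (shortenCol C U)) : m * finrank F U ∈ anticodeDims C i :=
  ⟨_, (isOptimalAnticode_shortenCol hnm U).1, by rwa [inf_shortenCol_top],
    (isOptimalAnticode_shortenCol hnm U).2⟩

theorem mem_anticodeDims_of_shortenRow (hnm : n = m)
    {C : Submodule F (Matrix (Fin n) (Fin m) F)} {i : ℕ} {U : Submodule F (Fin m → F)}
    (hU : i ≤ finrank F (shortenRow C U)) : m * finrank F U ∈ anticodeDims C i :=
  ⟨_, (isOptimalAnticode_shortenRow hnm U).1, by rwa [inf_shortenRow_top],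
    (isOptimalAnticode_shortenRow hnm U).2⟩

/-- An anticode dimension is bounded below by that of a standard anticode meeting `C` as much. -/
theorem exists_of_mem_anticodeDims (hnm : n ≤ m) {C : Submodule F (Matrix (Fin n) (Fin m) F)}
    {i d : ℕ} (hd : d ∈ anticodeDims C i) :
    (∃ U, i ≤ finrank F (shortenCol C U) ∧ m * finrank F U ≤ d) ∨
    (n = m ∧ ∃ U, i ≤ finrank F (shortenRow C U) ∧ m * finrank F U ≤ d) := by
  obtain ⟨A, hA, hi, rfl⟩ := hd
  rw [show finrank F A = m * maxrk A from hA]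
  rcases hA.colsp_le_or_rowsp_le hnm with ⟨V, hV, h⟩ | ⟨hsq, W, hW, h⟩
  · exact Or.inl ⟨V, hi.trans (Submodule.finrank_mono fun M hM => ⟨hM.1, h M hM.2⟩),
      Nat.mul_le_mul_left m hV⟩
  · exact Or.inr ⟨hsq, W, hi.trans (Submodule.finrank_mono fun M hM => ⟨hM.1, h M hM.2⟩),
      Nat.mul_le_mul_left m hW⟩

theorem genWeight_eq_of_isLeast (hm : 0 < m) {C : Submodule F (Matrix (Fin n) (Fin m) F)}
    {i u : ℕ} (h : IsLeast (anticodeDims C i) (m * u)) : genWeight C i = u := by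
  have hm' : (m : ℚ) ≠ 0 := by exact_mod_cast hm.ne'
  rw [genWeight, h.csInf_eq]
  push_cast
  field_simp

theorem one_le_finrank_iff {X : Type*} [AddCommGroup X] [Module F X] [FiniteDimensional F X]
    (S : Submodule F X) : 1 ≤ finrank F S ↔ ∃ x ∈ S, x ≠ 0 := by
  rw [Nat.one_le_iff_ne_zero, Ne, Submodule.finrank_eq_zero, ← Ne, Submodule.ne_bot_iff]

end RankMetric

/-! ### The main theorem -/

/-- The three nonemptiness clauses say that the minimum and the maxima that define the weights
are taken over nonempty (and clearly bounded) sets of dimensions. -/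
theorem mainTheorem7 {F : Type*} [Field F] [Finite F] {n m : ℕ} (hnm : n ≤ m)
    (C : Submodule F (Matrix (Fin n) (Fin m) F)) (hC : C ≠ ⊥) :
    (∀ i : ℕ, 1 ≤ i → i ≤ Module.finrank F C →
      (RankMetric.anticodeDims C i).Nonempty ∧
      ((RankMetric.colPM C).flatDims ((i : ℚ) / m)).Nonempty ∧
      ((RankMetric.rowPM C).flatDims ((i : ℚ) / n)).Nonempty ∧
      (n < m → RankMetric.genWeight C i = RankMetric.flatWeightCol C i) ∧
      (n = m → RankMetric.genWeight C i =
        min (RankMetric.flatWeightCol C i) (RankMetric.flatWeightRow C i))) ∧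
    (n = m → RankMetric.flatWeightCol C 1 = RankMetric.flatWeightRow C 1) := by
  have hn : 0 < n := by
    obtain ⟨M, -, hM⟩ := C.ne_bot_iff.1 hC
    rcases Nat.eq_zero_or_pos n with rfl | h
    · exact absurd (Subsingleton.elim M 0) hM
    · exact h
  have hm : 0 < m := hn.trans_le hnm
  refine ⟨fun i _ hi => ?_, fun hsq => ?_⟩
  · obtain ⟨hcne, U, hU, hUw, hUmin⟩ := RankMetric.exists_flatWeightCol_eq hm C hi
    obtain ⟨hrne, W, hW, hWw, hWmin⟩ := RankMetric.exists_flatWeightRow_eq hn C hi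
    refine ⟨⟨_, RankMetric.mem_anticodeDims_of_shortenCol hnm hU⟩, hcne, hrne,
      fun hlt => ?_, fun hsq => ?_⟩
    · rw [hUw]
      refine RankMetric.genWeight_eq_of_isLeast hm
        ⟨RankMetric.mem_anticodeDims_of_shortenCol hnm hU, fun d hd => ?_⟩
      rcases RankMetric.exists_of_mem_anticodeDims hnm hd with ⟨U', h, hle⟩ | ⟨h, -⟩
      · exact (Nat.mul_le_mul_left m (hUmin U' h)).trans hle
      · omega
    · rw [hUw, hWw, ← Nat.cast_min]
      refine RankMetric.genWeight_eq_of_isLeast hm ⟨?_, fun d hd => ?_⟩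
      · rcases min_choice (Module.finrank F U) (Module.finrank F W) with h | h <;> rw [h]
        · exact RankMetric.mem_anticodeDims_of_shortenCol hnm hU
        · exact RankMetric.mem_anticodeDims_of_shortenRow hsq hW
      · rcases RankMetric.exists_of_mem_anticodeDims hnm hd with ⟨U', h, hle⟩ | ⟨-, U', h, hle⟩
        · exact (Nat.mul_le_mul_left m ((min_le_left _ _).trans (hUmin U' h))).trans hle
        · exact (Nat.mul_le_mul_left m ((min_le_right _ _).trans (hWmin U' h))).trans hle
  · have hC1 : 1 ≤ Module.finrank F C :=
      (RankMetric.one_le_finrank_iff C).2 (C.ne_bot_iff.1 hC)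
    obtain ⟨-, U, hU, hUw, hUmin⟩ := RankMetric.exists_flatWeightCol_eq hm C hC1
    obtain ⟨-, W, hW, hWw, hWmin⟩ := RankMetric.exists_flatWeightRow_eq hn C hC1
    rw [hUw, hWw, Nat.cast_inj]
    obtain ⟨M, hM, hM0⟩ := (RankMetric.one_le_finrank_iff _).1 hU
    obtain ⟨N, hN, hN0⟩ := (RankMetric.one_le_finrank_iff _).1 hW
    -- A nonzero matrix attaining one weight is tested against the other through its own row or
    -- column space; row rank equals column rank.
    apply le_antisymm
    · refine (hUmin (RankMetric.colsp N)
        ((RankMetric.one_le_finrank_iff _).2 ⟨N, ⟨hN.1, le_rfl⟩, hN0⟩)).trans ?_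
      rw [← RankMetric.rank_eq_finrank_colsp, RankMetric.rank_eq_finrank_rowsp]
      exact Submodule.finrank_mono hN.2
    · refine (hWmin (RankMetric.rowsp M)
        ((RankMetric.one_le_finrank_iff _).2 ⟨M, ⟨hM.1, le_rfl⟩, hM0⟩)).trans ?_
      rw [← RankMetric.rank_eq_finrank_rowsp, RankMetric.rank_eq_finrank_colsp]
      exact Submodule.finrank_mono hM.2
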